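/- Let $n\ge 3$ and let $T$ be a triangulation of a convex $n$-gon with vertices $1,\dots,n$ in cyclic order (viewed combinatorially: the $n$ sides together with a maximal set of pairwise non-crossing diagonals; these are $2n-3$ edges in total). Assign independent indeterminates $x_{i,j}=x_{j,i}$ to the edges of $T$, where $x_{i,j}$ belongs to the edge joining vertices $i$ and $j$. Then there is a unique assignment of rational functions $M_{i,j}=M_{j,i}\in\mathbb{Q}(x_e : e\in T)$ to all sides and diagonals $\{i,j\}$ of the $n$-gon such that $M_{i,j}=x_{i,j}$ for every edge $\{i,j\}$ of $T$ and such that the Ptolemy relation $$M_{i,j}\,M_{k,l}+M_{j,k}\,M_{i,l}=M_{i,k}\,M_{j,l}$$ holds for any four distinct vertices $i,j,k,l$ listed in cyclic order. Moreover, every $M_{i,j}$ is a nonzero Laurent polynomial in the $2n-3$ indeterminates $x_e$ all of whose nonzero coefficients are positive integers. -/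

import Mathlib

noncomputable section

namespace Polygon

/-- The sides and diagonals of a convex `n`-gon whose vertices, in cyclic order, are the elements
`0, 1, …, n - 1` of `Fin n`. The segment joining two distinct vertices is represented by the pair
of its endpoints, the smaller one first. -/
abbrev Segment (n : ℕ) : Type := {p : Fin n × Fin n // p.1 < p.2}

/-- The segment joining the vertices `i < j`. -/
def seg {n : ℕ} (i j : Fin n) (h : i < j) : Segment n := ⟨(i, j), h⟩

/-- `s` is a side of the polygon: it joins `i` and `i + 1`, or the first and the last vertex. -/
def IsSide {n : ℕ} (s : Segment n) : Prop :=
  (s.1.1 : ℕ) + 1 = s.1.2 ∨ ((s.1.1 : ℕ) = 0 ∧ (s.1.2 : ℕ) + 1 = n)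

/-- A diagonal joins two distinct vertices that are not adjacent on the polygon. -/
def IsDiagonal {n : ℕ} (s : Segment n) : Prop := ¬ IsSide s

/-- Two segments cross (meet in an interior point of both) iff their endpoints interleave. -/
def Crosses {n : ℕ} (s t : Segment n) : Prop :=
  (s.1.1 < t.1.1 ∧ t.1.1 < s.1.2 ∧ s.1.2 < t.1.2) ∨
  (t.1.1 < s.1.1 ∧ s.1.1 < t.1.2 ∧ t.1.2 < s.1.2)

/-- `T` is the set of edges of a triangulation of the convex `n`-gon: all the sides, together with
a maximal set of pairwise non-crossing diagonals. -/
structure IsTriangulation {n : ℕ} (T : Set (Segment n)) : Prop where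
  side_mem : ∀ s, IsSide s → s ∈ T
  noncrossing : ∀ s ∈ T, ∀ t ∈ T, ¬ Crosses s t
  maximal : ∀ s, IsDiagonal s → (∀ t ∈ T, ¬ Crosses s t) → s ∈ T

/-- The field of rational functions over `ℚ` in indeterminates indexed by `E`. -/
abbrev RatFun (E : Type) : Type := FractionRing (MvPolynomial E ℚ)

/-- The indeterminate indexed by `e`, as a rational function. -/
def indet {E : Type} (e : E) : RatFun E :=
  algebraMap (MvPolynomial E ℚ) (RatFun E) (MvPolynomial.X e)

/-- The Laurent monomial with exponent vector `m`, as a rational function. -/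
def laurentMonomial {E : Type} (m : E →₀ ℤ) : RatFun E := m.prod fun e k => indet e ^ k

/-- `f` is a Laurent polynomial with positive (integer) coefficients: a finite nonempty sum of
Laurent monomials, each with a positive integer coefficient. Here `c m` is the coefficient of the
monomial with exponent vector `m`. -/
def IsPositiveLaurent {E : Type} (f : RatFun E) : Prop :=
  ∃ c : (E →₀ ℤ) →₀ ℤ, c ≠ 0 ∧ (∀ m ∈ c.support, 0 < c m) ∧
    f = c.sum fun m a => (a : RatFun E) * laurentMonomial m

/-- The Ptolemy relation for every quadrilateral with vertices among those of the `n`-gon. Up to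
rotating their names, which does not change the relation, four vertices in cyclic order satisfy
`i < j < k < l`. -/
def Ptolemy {n : ℕ} {K : Type} [Field K] (M : Segment n → K) : Prop :=
  ∀ (i j k l : Fin n) (hij : i < j) (hjk : j < k) (hkl : k < l),
    M (seg i j hij) * M (seg k l hkl) + M (seg j k hjk) * M (seg i l (hij.trans (hjk.trans hkl))) =
      M (seg i k (hij.trans hjk)) * M (seg j l (hjk.trans hkl))

/-- `M` assigns rational functions to all the sides and diagonals, extends the assignment of the
formal weights (distinct indeterminates) to the edges of `T`, and satisfies the Ptolemy relations. -/
structure IsPtolemyExtension {n : ℕ} (T : Set (Segment n)) (M : Segment n → RatFun T) : Prop where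
  extends_weights : ∀ e : T, M e.1 = indet e
  ptolemy : Ptolemy M

end Polygon

end

/-! Existence: pick plane vectors, one per vertex, whose determinants on the edges of `T` are the
indeterminates; the Plücker relation makes all their pairwise determinants a Ptolemy extension
(`exists_vectors`, `ptolemy_det₂`). Uniqueness and positivity: every segment is reached from `T` by
Ptolemy relations in which one diagonal is an edge of `T` (`segment_induction`). So one only ever
divides by an indeterminate, and the Laurent property needs no cancellation argument. -/

namespace Polygon

/-! ### Triangles and inductions in a triangulation -/

section Triangulation

variable {n : ℕ} {T : Set (Segment n)}

/-- Every edge of a triangulation that cuts off at least one vertex is the long side of a triangle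
of the triangulation. -/
theorem IsTriangulation.exists_triangle (hT : IsTriangulation T) {a b : Fin n} (hab : a < b)
    (hmem : seg a b hab ∈ T) (hne : (a : ℕ) + 1 ≠ b) :
    ∃ (c : Fin n) (hac : a < c) (hcb : c < b), seg a c hac ∈ T ∧ seg c b hcb ∈ T := by
  classical
  let S : Finset (Fin n) := Finset.univ.filter fun c => c < b ∧ ∃ h : a < c, seg a c h ∈ T
  have hab' : (a : ℕ) < b := hab
  have hS : S.Nonempty := by
    refine ⟨⟨a + 1, by omega⟩, ?_⟩
    simp only [S, Finset.mem_filter, Finset.mem_univ, true_and]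
    refine ⟨by rw [Fin.lt_def]; simp only; omega, by rw [Fin.lt_def]; simp, ?_⟩
    exact hT.side_mem _ (Or.inl rfl)
  -- Take the last neighbour `c` of `a` before `b`. An edge crossing `cb` but neither `ab` nor `ac`
  -- would start at `a` and end strictly between `c` and `b`.
  obtain ⟨c, hcS, hmax⟩ := S.exists_max_image id hS
  simp only [S, Finset.mem_filter, Finset.mem_univ, true_and, id] at hcS hmax
  obtain ⟨hcb, hac, hacT⟩ := hcS
  refine ⟨c, hac, hcb, hacT, ?_⟩
  by_cases hside : IsSide (seg c b hcb)
  · exact hT.side_mem _ hside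
  refine hT.maximal _ hside ?_
  rintro ⟨⟨p, q⟩, hpq⟩ htT hcross
  have h₁ := hT.noncrossing _ htT _ hmem
  have h₂ := hT.noncrossing _ htT _ hacT
  simp only [Crosses, seg] at hcross h₁ h₂ hpq
  have h₃ : p = a → q < b → q ≤ c := by
    rintro rfl hqb
    exact hmax q ⟨hqb, hpq, htT⟩
  omega

/-- Induction over the edges of a triangulation, from the sides inwards. -/
theorem IsTriangulation.edge_induction (hT : IsTriangulation T) {P : Fin n → Fin n → Prop}
    (side : ∀ a b : Fin n, (a : ℕ) + 1 = b → P a b)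
    (triangle : ∀ (a c b : Fin n) (hac : a < c) (hcb : c < b), seg a c hac ∈ T →
      seg c b hcb ∈ T → seg a b (hac.trans hcb) ∈ T → P a c → P c b → P a b)
    {a b : Fin n} (hab : a < b) (hmem : seg a b hab ∈ T) : P a b := by
  induction hd : (b : ℕ) - a using Nat.strong_induction_on generalizing a b with
  | _ d ih =>
    by_cases h : (a : ℕ) + 1 = b
    · exact side a b h
    obtain ⟨c, hac, hcb, hacT, hcbT⟩ := hT.exists_triangle hab hmem h
    have h₁ : (a : ℕ) < c := hac
    have h₂ : (c : ℕ) < b := hcb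
    exact triangle a c b hac hcb hacT hcbT hmem (ih _ (by omega) hac hacT rfl)
      (ih _ (by omega) hcb hcbT rfl)

/-- A property of segments holds for all of them if it holds for the edges of a triangulation and
passes from the other five segments of a quadrilateral to the sixth one whenever this is a diagonal
and the other diagonal is an edge of the triangulation. -/
theorem IsTriangulation.segment_induction (hT : IsTriangulation T) (hn : 2 ≤ n)
    {Q : Segment n → Prop} (edge : ∀ s ∈ T, Q s)
    (flip : ∀ (i j k l : Fin n) (hij : i < j) (hjk : j < k) (hkl : k < l),
      seg i k (hij.trans hjk) ∈ T → Q (seg i j hij) → Q (seg k l hkl) → Q (seg j k hjk) →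
      Q (seg i l (hij.trans (hjk.trans hkl))) → Q (seg j l (hjk.trans hkl)))
    (flip' : ∀ (i j k l : Fin n) (hij : i < j) (hjk : j < k) (hkl : k < l),
      seg j l (hjk.trans hkl) ∈ T → Q (seg i j hij) → Q (seg k l hkl) → Q (seg j k hjk) →
      Q (seg i l (hij.trans (hjk.trans hkl))) → Q (seg i k (hij.trans hjk)))
    (s : Segment n) : Q s := by
  have key : ∀ {a b : Fin n} (hab : a < b), seg a b hab ∈ T →
      ∀ (i j : Fin n) (hij : i < j), a ≤ i → j ≤ b → Q (seg i j hij) := by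
    intro a b hab hmem
    refine hT.edge_induction (P := fun a b => ∀ (i j : Fin n) (hij : i < j), a ≤ i → j ≤ b →
      Q (seg i j hij)) ?_ ?_ hab hmem
    · intro a b h i j hij hai hjb
      refine edge _ (hT.side_mem _ (Or.inl ?_))
      simp only [seg]
      omega
    · intro a c b hac hcb hacT hcbT habT ihl ihr i j hij hai hjb
      have hright : ∀ (i : Fin n) (hic : i < c), a ≤ i → Q (seg i b (hic.trans hcb)) := by
        intro i hic hai
        rcases hai.eq_or_lt with rfl | hai
        · exact edge _ habT
        · exact flip a i c b hai hic hcb hacT (ihl _ _ _ le_rfl hic.le) (edge _ hcbT)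
            (ihl _ _ _ hai.le le_rfl) (edge _ habT)
      -- Quadrilateral `a, c, j, b`, whose diagonal `cb` lies in `T`.
      have hleft : ∀ (j : Fin n) (hcj : c < j), j ≤ b → Q (seg a j (hac.trans hcj)) := by
        intro j hcj hjb
        rcases hjb.eq_or_lt with rfl | hjb
        · exact edge _ habT
        · exact flip' a c j b hac hcj hjb hcbT (edge _ hacT) (ihr _ _ _ hcj.le le_rfl)
            (ihr _ _ _ le_rfl hjb.le) (edge _ habT)
      rcases le_or_gt j c with hjc | hcj
      · exact ihl i j hij hai hjc
      rcases le_or_gt c i with hci | hic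
      · exact ihr i j hij hci hjb
      -- A segment passing over `c`: quadrilateral `a, i, c, j` with diagonal `ac` in `T`, its side
      -- `aj` being supplied by `hleft`.
      rcases hai.eq_or_lt with rfl | hai
      · exact hleft j hcj hjb
      · exact flip a i c j hai hic hcj hacT (ihl _ _ _ le_rfl hic.le) (ihr _ _ _ le_rfl hjb)
          (ihl _ _ _ hai.le le_rfl) (hleft j hcj hjb)
  obtain ⟨⟨i, j⟩, hij⟩ := s
  have hlt : (⟨0, by omega⟩ : Fin n) < ⟨n - 1, by omega⟩ := by
    rw [Fin.lt_def]; simp only; omega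
  refine key hlt (hT.side_mem _ (Or.inr ⟨rfl, ?_⟩)) i j hij ?_ ?_
  · simp only [seg]; omega
  · rw [Fin.le_def]; simp
  · rw [Fin.le_def]; simp only; omega

/-! ### Realizing weights by plane vectors -/

/-- The determinant of two vectors of the plane. -/
def det₂ {K : Type} [Field K] (v w : K × K) : K := v.1 * w.2 - v.2 * w.1

/-- This is the three-term Plücker relation for the 2 × 2 minors of a 2 × n matrix. -/
theorem ptolemy_det₂ {K : Type} [Field K] (v : Fin n → K × K) :
    Ptolemy fun s : Segment n => det₂ (v s.1.1) (v s.1.2) := by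
  intro i j k l _ _ _
  simp only [det₂, seg]
  ring

/-- Nonzero weights on the edges of a triangulation are the pairwise determinants of a
configuration of vectors. -/
theorem IsTriangulation.exists_vectors (hT : IsTriangulation T) (hn : 2 ≤ n) {K : Type} [Field K]
    (w : Segment n → K) (hw : ∀ s ∈ T, w s ≠ 0) :
    ∃ v : Fin n → K × K, ∀ s ∈ T, det₂ (v s.1.1) (v s.1.2) = w s := by
  -- The end vectors `p`, `q` are prescribed, so that the configurations on both sides of a
  -- triangle's apex can be glued.
  have key : ∀ {a b : Fin n} (hab : a < b), seg a b hab ∈ T →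
      ∀ (hab : a < b) (p q : K × K), det₂ p q = w (seg a b hab) →
        ∃ v : Fin n → K × K, v a = p ∧ v b = q ∧ ∀ (i j : Fin n) (hij : i < j), a ≤ i → j ≤ b →
          seg i j hij ∈ T → det₂ (v i) (v j) = w (seg i j hij) := by
    intro a b hab hmem
    refine hT.edge_induction (P := fun a b => ∀ (hab : a < b) (p q : K × K),
      det₂ p q = w (seg a b hab) → ∃ v : Fin n → K × K, v a = p ∧ v b = q ∧
        ∀ (i j : Fin n) (hij : i < j), a ≤ i → j ≤ b →
          seg i j hij ∈ T → det₂ (v i) (v j) = w (seg i j hij)) ?_ ?_ hab hmem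
    · intro a b h hab p q hpq
      refine ⟨fun i => if i = a then p else q, by simp, by simp [hab.ne'], ?_⟩
      intro i j hij hai hjb _
      obtain rfl : i = a := by omega
      obtain rfl : j = b := by omega
      simpa [hij.ne'] using hpq
    · intro a c b hac hcb hacT hcbT habT ihl ihr hab p q hpq
      have hne : w (seg a b hab) ≠ 0 := hw _ habT
      set x := w (seg a b hab) with hx
      set y := w (seg a c hac) with hy
      set z := w (seg c b hcb) with hz
      -- Cramer's rule for `det₂ p r = y` and `det₂ r q = z`, given `det₂ p q = x`.
      let r : K × K := (z / x * p.1 + y / x * q.1, z / x * p.2 + y / x * q.2)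
      have hpr : det₂ p r = y := by
        have : det₂ p r = y / x * det₂ p q := by simp only [det₂, r]; ring
        rw [this, hpq, div_mul_cancel₀ _ hne]
      have hrq : det₂ r q = z := by
        have : det₂ r q = z / x * det₂ p q := by simp only [det₂, r]; ring
        rw [this, hpq, div_mul_cancel₀ _ hne]
      obtain ⟨v₁, h₁a, h₁c, h₁⟩ := ihl hac p r hpr
      obtain ⟨v₂, h₂c, h₂b, h₂⟩ := ihr hcb r q hrq
      have hv₂ : ∀ i, c ≤ i → (if i ≤ c then v₁ i else v₂ i) = v₂ i := by
        intro i hi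
        rcases hi.eq_or_lt with rfl | hi
        · simp [h₁c, h₂c]
        · simp [hi]
      refine ⟨fun i => if i ≤ c then v₁ i else v₂ i, by simp [hac.le, h₁a],
        by simp [hcb, h₂b], ?_⟩
      intro i j hij hai hjb hijT
      rcases le_or_gt j c with hjc | hcj
      · simpa [hjc, hij.le.trans hjc] using h₁ i j hij hai hjc hijT
      rcases le_or_gt c i with hci | hic
      · simpa only [hv₂ i hci, hv₂ j hcj.le] using h₂ i j hij hci hjb hijT
      -- An edge of `T` passing over `c` crosses neither `ac` nor `cb`, so it is `ab`.
      have n₁ := hT.noncrossing _ hijT _ hacT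
      have n₂ := hT.noncrossing _ hijT _ hcbT
      simp only [Crosses, seg] at n₁ n₂
      obtain rfl : i = a := by omega
      obtain rfl : j = b := by omega
      simpa [hic.le, hcj.not_ge, h₁a, h₂b] using hpq
  have hlt : (⟨0, by omega⟩ : Fin n) < ⟨n - 1, by omega⟩ := by
    rw [Fin.lt_def]; simp only; omega
  obtain ⟨v, -, -, hv⟩ := key hlt (hT.side_mem _ (Or.inr ⟨rfl, by simp only [seg]; omega⟩)) hlt
    (1, 0) (0, w (seg _ _ hlt)) (by simp [det₂])
  refine ⟨v, ?_⟩
  rintro ⟨⟨i, j⟩, hij⟩ hs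
  refine hv i j hij ?_ ?_ hs
  · rw [Fin.le_def]; simp
  · rw [Fin.le_def]; simp only; omega

end Triangulation

/-! ### Closure properties of positive Laurent polynomials -/

section Laurent

variable {E : Type}

theorem indet_ne_zero (e : E) : indet e ≠ 0 := by
  rw [indet, Ne, FaithfulSMul.algebraMap_eq_zero_iff]
  exact MvPolynomial.X_ne_zero e

theorem laurentMonomial_add (m m' : E →₀ ℤ) :
    laurentMonomial (m + m') = laurentMonomial m * laurentMonomial m' := by
  classical
  exact Finsupp.prod_add_index (fun _ _ => zpow_zero _)
    fun e _ k l => zpow_add₀ (indet_ne_zero e) k l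

theorem isPositiveLaurent_term (m : E →₀ ℤ) {a : ℤ} (ha : 0 < a) :
    IsPositiveLaurent ((a : RatFun E) * laurentMonomial m) := by
  refine ⟨Finsupp.single m a, by simpa using ha.ne', ?_, ?_⟩
  · intro m' hm'
    obtain rfl : m' = m := by
      simpa using Finsupp.support_single_subset hm'
    simpa using ha
  · rw [Finsupp.sum_single_index (by simp)]

theorem isPositiveLaurent_indet_zpow (e : E) (k : ℤ) : IsPositiveLaurent (indet e ^ k) := by
  have h := isPositiveLaurent_term (Finsupp.single e k) one_pos
  rwa [laurentMonomial, Finsupp.prod_single_index (zpow_zero _), Int.cast_one, one_mul] at h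

/-- Positive coefficients cannot cancel, so the sum keeps a nonzero coefficient. -/
theorem IsPositiveLaurent.add {f g : RatFun E} (hf : IsPositiveLaurent f)
    (hg : IsPositiveLaurent g) : IsPositiveLaurent (f + g) := by
  classical
  obtain ⟨c, hc, hpos, rfl⟩ := hf
  obtain ⟨d, -, hpos', rfl⟩ := hg
  have nonneg : ∀ c : (E →₀ ℤ) →₀ ℤ, (∀ m ∈ c.support, 0 < c m) → ∀ m, 0 ≤ c m := by
    intro c hc m
    by_cases hm : m ∈ c.support
    · exact (hc m hm).le
    · rw [Finsupp.notMem_support_iff.mp hm]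
  refine ⟨c + d, ?_, ?_, ?_⟩
  · obtain ⟨m, hm⟩ := Finsupp.support_nonempty_iff.mpr hc
    intro h
    have h₀ := DFunLike.congr_fun h m
    simp only [Finsupp.add_apply, Finsupp.zero_apply] at h₀
    linarith [hpos m hm, nonneg d hpos' m]
  · intro m hm
    rw [Finsupp.mem_support_iff] at hm
    exact lt_of_le_of_ne (add_nonneg (nonneg c hpos m) (nonneg d hpos' m)) hm.symm
  · rw [Finsupp.sum_add_index' (by simp) fun m a b => by push_cast; ring]

theorem isPositiveLaurent_sum {ι : Type} {s : Finset ι} (hs : s.Nonempty) {f : ι → RatFun E}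
    (hf : ∀ i ∈ s, IsPositiveLaurent (f i)) : IsPositiveLaurent (∑ i ∈ s, f i) :=
  Finset.sum_induction_nonempty f IsPositiveLaurent (fun _ _ => IsPositiveLaurent.add) hs hf

theorem IsPositiveLaurent.mul {f g : RatFun E} (hf : IsPositiveLaurent f)
    (hg : IsPositiveLaurent g) : IsPositiveLaurent (f * g) := by
  obtain ⟨c, hc, hpos, rfl⟩ := hf
  obtain ⟨d, hd, hpos', rfl⟩ := hg
  rw [Finsupp.sum, Finsupp.sum, Finset.sum_mul_sum]
  refine isPositiveLaurent_sum (Finsupp.support_nonempty_iff.mpr hc) fun m hm =>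
    isPositiveLaurent_sum (Finsupp.support_nonempty_iff.mpr hd) fun m' hm' => ?_
  have h := isPositiveLaurent_term (m + m') (mul_pos (hpos m hm) (hpos' m' hm'))
  rwa [laurentMonomial_add, Int.cast_mul, mul_mul_mul_comm] at h

/-- The inverse of an indeterminate is itself a positive Laurent monomial. This is the only division
that positivity requires. -/
theorem IsPositiveLaurent.of_indet_mul {e : E} {f : RatFun E}
    (h : IsPositiveLaurent (indet e * f)) : IsPositiveLaurent f := by
  have h' := (isPositiveLaurent_indet_zpow e (-1)).mul h
  rwa [zpow_neg_one, inv_mul_cancel_left₀ (indet_ne_zero e)] at h'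

end Laurent

/-! ### Existence, uniqueness and positivity of the extension -/

section Extension

variable {n : ℕ} {T : Set (Segment n)}

theorem IsTriangulation.exists_isPtolemyExtension (hT : IsTriangulation T) (hn : 2 ≤ n) :
    ∃ M : Segment n → RatFun T, IsPtolemyExtension T M := by
  classical
  obtain ⟨v, hv⟩ := hT.exists_vectors hn
    (fun s => if h : s ∈ T then indet (⟨s, h⟩ : T) else 0)
    fun s hs => by simpa only [dif_pos hs] using indet_ne_zero (⟨s, hs⟩ : T)
  exact ⟨_, fun e => by simpa using hv e.1 e.2, ptolemy_det₂ v⟩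

theorem IsPtolemyExtension.apply_mem {M : Segment n → RatFun T} (hM : IsPtolemyExtension T M)
    {s : Segment n} (hs : s ∈ T) : M s = indet ⟨s, hs⟩ :=
  hM.extends_weights ⟨s, hs⟩

theorem IsPtolemyExtension.eq (hT : IsTriangulation T) (hn : 2 ≤ n) {M N : Segment n → RatFun T}
    (hM : IsPtolemyExtension T M) (hN : IsPtolemyExtension T N) : M = N := by
  funext s
  refine hT.segment_induction hn (Q := fun s => M s = N s) ?_ ?_ ?_ s
  · intro s hs
    rw [hM.apply_mem hs, hN.apply_mem hs]
  · intro i j k l hij hjk hkl hik h₁ h₂ h₃ h₄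
    have h := hM.ptolemy i j k l hij hjk hkl
    rw [h₁, h₂, h₃, h₄, hN.ptolemy i j k l hij hjk hkl, hM.apply_mem hik, hN.apply_mem hik] at h
    exact (mul_left_cancel₀ (indet_ne_zero _) h).symm
  · intro i j k l hij hjk hkl hjl h₁ h₂ h₃ h₄
    have h := hM.ptolemy i j k l hij hjk hkl
    rw [h₁, h₂, h₃, h₄, hN.ptolemy i j k l hij hjk hkl, hM.apply_mem hjl, hN.apply_mem hjl] at h
    exact (mul_right_cancel₀ (indet_ne_zero _) h).symm

theorem IsPtolemyExtension.isPositiveLaurent (hT : IsTriangulation T) (hn : 2 ≤ n)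
    {M : Segment n → RatFun T} (hM : IsPtolemyExtension T M) (s : Segment n) :
    IsPositiveLaurent (M s) := by
  refine hT.segment_induction hn (Q := fun s => IsPositiveLaurent (M s)) ?_ ?_ ?_ s
  · intro s hs
    rw [hM.apply_mem hs, ← zpow_one (indet _)]
    exact isPositiveLaurent_indet_zpow _ 1
  · intro i j k l hij hjk hkl hik h₁ h₂ h₃ h₄
    have h := (h₁.mul h₂).add (h₃.mul h₄)
    rw [hM.ptolemy i j k l hij hjk hkl, hM.apply_mem hik] at h
    exact h.of_indet_mul
  · intro i j k l hij hjk hkl hjl h₁ h₂ h₃ h₄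
    have h := (h₁.mul h₂).add (h₃.mul h₄)
    rw [hM.ptolemy i j k l hij hjk hkl, hM.apply_mem hjl, mul_comm] at h
    exact h.of_indet_mul

end Extension

end Polygon

theorem theorem3 (n : ℕ) (hn : 3 ≤ n) (T : Set (Polygon.Segment n))
    (hT : Polygon.IsTriangulation T) :
    (∃! M : Polygon.Segment n → Polygon.RatFun T, Polygon.IsPtolemyExtension T M) ∧
      ∀ M : Polygon.Segment n → Polygon.RatFun T, Polygon.IsPtolemyExtension T M →
        ∀ s : Polygon.Segment n, Polygon.IsPositiveLaurent (M s) := by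
  have hn' : 2 ≤ n := by omega
  obtain ⟨M, hM⟩ := hT.exists_isPtolemyExtension hn'
  exact ⟨⟨M, hM, fun N hN => Polygon.IsPtolemyExtension.eq hT hn' hN hM⟩,
    fun N hN s => hN.isPositiveLaurent hT hn' s⟩
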